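/- Consider three subsystems (players) $i=1,2,3$ with states $x_i\in\mathbb{R}^{n_i}$, inputs $u_i\in\mathbb{R}^{q_i}$ and outputs $y_i\in\mathbb{R}^{p_i}$, and the stacked system $$x(k+1)=Ax(k)+Bu(k)+w(k),\qquad y(k)=Cx(k)+v(k),\qquad k=0,1,2,\dots,$$ $$A=\begin{bmatrix}A_{11}&0&A_{13}\\A_{21}&A_{22}&0\\0&A_{32}&A_{33}\end{bmatrix},\quad B=\operatorname{diag}(B_1,B_2,B_3),\quad C=\operatorname{diag}(C_1,C_2,C_3).$$ The initial state $x(0)$ and the noises $w(k),v(k)$, $k\ge 0$, are jointly Gaussian with mean zero; $\mathbf{E}\{x(0)x(0)^T\}=P_0$, $x(0)$ is independent of the noises, $\mathbf{E}\{w(k)w(l)^T\}=\delta(k-l)W$, $\mathbf{E}\{v(k)v(l)^T\}=\delta(k-l)V$ and $\mathbf{E}\{w(k)v(l)^T\}=0$ for all $k,l$. Write $y(0:k)$ for $y(0),\dots,y(k)$ (empty if $k<0$). At time $k$ the players know $$\mathcal I_1(k)=\{y_1(k),y_1(k-1),y_3(k-1),y(0:k-2)\},\quad \mathcal I_2(k)=\{y_2(k),y_1(k-1),y_2(k-1),y(0:k-2)\},$$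 $$\mathcal I_3(k)=\{y_3(k),y_2(k-1),y_3(k-1),y(0:k-2)\},$$ and $u_i(k)$ is an integrable Borel function of $\mathcal I_i(k)$. Let $\mathcal I^{[1]}_i(k)$ consist of the measurements in $\mathcal I_i(k)$ taken up to time $k-1$. Define $$\widehat x(k|k-1)=\mathbf{E}\{x(k)\,|\,y(0:k-1)\},\qquad \widehat x^{[1]}_i(k)=\mathbf{E}\{x_i(k)\,|\,\mathcal I^{[1]}_i(k)\},$$ $$e(k)=x(k)-\widehat x(k|k-1),\quad \widetilde y(k)=y(k)-C\widehat x(k|k-1),\quad e^{[1]}(k)=x(k)-\widehat x^{[1]}(k),\quad \widetilde y^{[1]}(k)=y(k)-C\widehat x^{[1]}(k),$$ and let $P(k),\widetilde Y(k),P^{[1]}(k),\widetilde Y^{[1]}(k)$ be the covariance matrices of $e(k),\widetilde y(k),e^{[1]}(k),\widetilde y^{[1]}(k)$. When $V$ is positive definite, let $$K(k)=AP(k)C^T\bigl(CP(k)C^T+V\bigr)^{-1},$$ and let $K^{[1]}(k)$ be the matrix whose $(i,j)$ block is zero for $j\notin S_i$, where $S_1=\{1,3\}$, $S_2=\{1,2\}$,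 $S_3=\{2,3\}$, and whose blocks $(i,j)$, $j\in S_i$, form the matrix $$[A]_i[P(k)]_{S_tS_i}[C]_{S_iS_i}^T\bigl([C]_{S_iS_i}[P(k)]_{S_iS_i}[C]_{S_iS_i}^T+[V]_{S_iS_i}\bigr)^{-1},$$ where $S_t=\{1,2,3\}$, $[A]_i$ is the $i$-th block row of $A$ and $[X]_{ST}$ is the submatrix of $X$ of the block rows in $S$ and block columns in $T$. Put $\Delta K(k)=K(k)-K^{[1]}(k)$. Then $x(k)$ is integrable, and $e(k),\widetilde y(k),e^{[1]}(k),\widetilde y^{[1]}(k)$ are square integrable with mean zero, for all $k\ge 0$, and the following hold. (a) If $V$ is positive definite, then $P^{[1]}(k)=P(k)+\Delta K(k-1)\widetilde Y(k-1)\Delta K(k-1)^T$ for all $k\ge 1$. (b) $\widetilde Y^{[1]}(k)=CP^{[1]}(k)C^T+V$ for all $k\ge 0$; if $V$ is positive definite, so is $\widetilde Y^{[1]}(k)$. (c) If $V$ is positive definite, then $\mathbf{E}\{e^{[1]}(k)\widetilde y(k-1)^T\}=\Delta K(k-1)\widetilde Y(k-1)$ for all $k\ge 1$. -/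

import Mathlib

open MeasureTheory ProbabilityTheory Matrix

namespace ThreePlayer

/-- Coordinates of a vector made of three blocks of sizes `d 0`, `d 1`, `d 2`.
The players 1, 2, 3 are the elements `0, 1, 2` of `Fin 3`. -/
abbrev Idx (d : Fin 3 → ℕ) : Type := (i : Fin 3) × Fin (d i)

/-- The data of the three-player problem. `A i j`, `B i`, `C i` are the blocks of the system
matrices, `W` and `V` the covariances of the process and measurement noise, `P₀` the covariance of
the initial state. -/
structure System (n q p : Fin 3 → ℕ) where
  A : (i j : Fin 3) → Matrix (Fin (n i)) (Fin (n j)) ℝ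
  B : (i : Fin 3) → Matrix (Fin (n i)) (Fin (q i)) ℝ
  C : (i : Fin 3) → Matrix (Fin (p i)) (Fin (n i)) ℝ
  W : Matrix (Idx n) (Idx n) ℝ
  V : Matrix (Idx p) (Idx p) ℝ
  P₀ : Matrix (Idx n) (Idx n) ℝ
  A_01 : A 0 1 = 0
  A_12 : A 1 2 = 0
  A_20 : A 2 0 = 0

/-- `delay j i` is the number of time steps after which information of player `j` reaches
player `i` in the graph with arrows `0 → 1 → 2 → 0`. -/
def delay (j i : Fin 3) : ℕ := (!![0, 1, 2; 2, 0, 1; 1, 2, 0] : Matrix (Fin 3) (Fin 3) ℕ) j i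

/-- The labels `(j, t)` of the measurements `y_j(t)` with `t ≤ k - 1`. -/
def pastSet (k : ℕ) : Set (Fin 3 × ℕ) := {s | s.2 < k}

/-- The labels `(j, t)` of the measurements `y_j(t)` available to player `i` at time `k`. -/
def infoSet (i : Fin 3) (k : ℕ) : Set (Fin 3 × ℕ) := {s | s.2 + delay s.1 i ≤ k}

/-- The labels of the measurements up to time `k - 1` available to player `i` at time `k`. -/
def localSet (i : Fin 3) (k : ℕ) : Set (Fin 3 × ℕ) := infoSet i k ∩ pastSet k

/-- Values of the measurements with labels in `T`. -/
abbrev Obs (p : Fin 3 → ℕ) (T : Set (Fin 3 × ℕ)) : Type := (s : T) → Fin (p s.1.1) → ℝ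

section Signals

variable {Ω : Type*} {n q p : Fin 3 → ℕ}

/-- The measurements with labels in `T`, as a random element. -/
def obs (y : ℕ → Ω → Idx p → ℝ) (T : Set (Fin 3 × ℕ)) (ω : Ω) : Obs p T :=
  fun s a => y s.1.2 ω ⟨s.1.1, a⟩

/-- The σ-algebra generated by the measurements with labels in `T`. -/
abbrev obsSigma (y : ℕ → Ω → Idx p → ℝ) (T : Set (Fin 3 × ℕ)) : MeasurableSpace Ω :=
  MeasurableSpace.comap (obs y T) inferInstance

/-- All scalar random variables driving the system: the coordinates of the initial state `x₀`
and of the noises `w k`, `v k`. -/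
def driving (x₀ : Ω → Idx n → ℝ) (w : ℕ → Ω → Idx n → ℝ) (v : ℕ → Ω → Idx p → ℝ) :
    Idx n ⊕ (ℕ × Idx n) ⊕ (ℕ × Idx p) → Ω → ℝ
  | .inl a, ω => x₀ ω a
  | .inr (.inl (k, a)), ω => w k ω a
  | .inr (.inr (k, b)), ω => v k ω b

end Signals

namespace System

variable {n q p : Fin 3 → ℕ}

/-- The full state matrix, with blocks `A i j`. -/
def matA (S : System n q p) : Matrix (Idx n) (Idx n) ℝ :=
  Matrix.of fun r c => S.A r.1 c.1 r.2 c.2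

/-- The full input matrix `diag (B 0, B 1, B 2)`. -/
def matB (S : System n q p) : Matrix (Idx n) (Idx q) ℝ := Matrix.blockDiagonal' S.B

/-- The full output matrix `diag (C 0, C 1, C 2)`. -/
def matC (S : System n q p) : Matrix (Idx p) (Idx n) ℝ := Matrix.blockDiagonal' S.C

/-- The Kalman gain belonging to the prediction error covariance `P`. -/
noncomputable def gain (S : System n q p) (P : Matrix (Idx n) (Idx n) ℝ) :
    Matrix (Idx n) (Idx p) ℝ :=
  S.matA * P * S.matCᵀ * (S.matC * P * S.matCᵀ + S.V)⁻¹

/-- `near i j` says that `j` belongs to the set `S_i` of players whose measurement at time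
`k - 1` is available to player `i` at time `k`. -/
abbrev near (i j : Fin 3) : Prop := delay j i ≤ 1

/-- The nonzero part of the block row of player `i` in the local gain,
`[A]_i [P]_{S_t S_i} [C]_{S_i S_i}ᵀ ([C]_{S_i S_i} [P]_{S_i S_i} [C]_{S_i S_i}ᵀ + [V]_{S_i S_i})⁻¹`,
where `S_t` is the set of all players. -/
noncomputable def localGainRow (S : System n q p) (P : Matrix (Idx n) (Idx n) ℝ) (i : Fin 3) :
    Matrix (Fin (n i)) {c : Idx p // near i c.1} ℝ :=
  let Ai : Matrix (Fin (n i)) (Idx n) ℝ := S.matA.submatrix (fun a => ⟨i, a⟩) id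
  let Pt : Matrix (Idx n) {c : Idx n // near i c.1} ℝ := P.submatrix id Subtype.val
  let Pi : Matrix {c : Idx n // near i c.1} {c : Idx n // near i c.1} ℝ :=
    P.submatrix Subtype.val Subtype.val
  let Ci : Matrix {c : Idx p // near i c.1} {c : Idx n // near i c.1} ℝ :=
    S.matC.submatrix Subtype.val Subtype.val
  let Vi : Matrix {c : Idx p // near i c.1} {c : Idx p // near i c.1} ℝ :=
    S.V.submatrix Subtype.val Subtype.val
  Ai * Pt * Ciᵀ * (Ci * Pi * Ciᵀ + Vi)⁻¹

/-- The local gain `K^{[1]}` belonging to the prediction error covariance `P`. -/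
noncomputable def localGain (S : System n q p) (P : Matrix (Idx n) (Idx n) ℝ) :
    Matrix (Idx n) (Idx p) ℝ :=
  Matrix.of fun r c =>
    if h : near r.1 c.1 then S.localGainRow P r.1 r.2 ⟨c, h⟩ else 0

/-- The closed loop: the processes `x, u, y` are generated by the system `S`, driven by the
Gaussian initial state `x 0` and the Gaussian white noises `w, v`, under control laws which are
Borel functions of the available information. -/
structure IsClosedLoop {Ω : Type*} [MeasurableSpace Ω] (S : System n q p) (μ : Measure Ω)
    (x : ℕ → Ω → Idx n → ℝ) (u : ℕ → Ω → Idx q → ℝ) (y : ℕ → Ω → Idx p → ℝ)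
    (w : ℕ → Ω → Idx n → ℝ) (v : ℕ → Ω → Idx p → ℝ) : Prop where
  state : ∀ k ω, x (k + 1) ω = S.matA *ᵥ x k ω + S.matB *ᵥ u k ω + w k ω
  output : ∀ k ω, y k ω = S.matC *ᵥ x k ω + v k ω
  measurable_driving : ∀ s, Measurable (driving (x 0) w v s)
  gaussian : IsGaussianProcess (driving (x 0) w v) μ
  mean_zero : ∀ s, ∫ ω, driving (x 0) w v s ω ∂μ = 0
  cov_init : ∀ a b, ∫ ω, x 0 ω a * x 0 ω b ∂μ = S.P₀ a b
  cov_init_w : ∀ k a b, ∫ ω, x 0 ω a * w k ω b ∂μ = 0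
  cov_init_v : ∀ k a b, ∫ ω, x 0 ω a * v k ω b ∂μ = 0
  cov_w : ∀ k l a b, ∫ ω, w k ω a * w l ω b ∂μ = if k = l then S.W a b else 0
  cov_v : ∀ k l a b, ∫ ω, v k ω a * v l ω b ∂μ = if k = l then S.V a b else 0
  cov_w_v : ∀ k l a b, ∫ ω, w k ω a * v l ω b ∂μ = 0
  control : ∀ i k, ∃ γ : Obs p (infoSet i k) → Fin (q i) → ℝ,
    Measurable γ ∧ ∀ ω a, u k ω ⟨i, a⟩ = γ (obs y (infoSet i k) ω) a
  control_integrable : ∀ k b, Integrable (fun ω => u k ω b) μ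

end System

section Estimation

variable {Ω : Type*} [MeasurableSpace Ω] {n p : Fin 3 → ℕ}

/-- The matrix `E{X Yᵀ}`. -/
noncomputable def crossMoment {ι κ : Type*} (μ : Measure Ω) (X : Ω → ι → ℝ) (Y : Ω → κ → ℝ) :
    Matrix ι κ ℝ :=
  Matrix.of fun a b => ∫ ω, X ω a * Y ω b ∂μ

/-- `X` has square integrable coordinates of mean zero, so that `crossMoment μ X X` is its
covariance matrix. -/
def IsCentredL2 {ι : Type*} (μ : Measure Ω) (X : Ω → ι → ℝ) : Prop :=
  ∀ a, MemLp (fun ω => X ω a) 2 μ ∧ ∫ ω, X ω a ∂μ = 0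

/-- The one-step prediction `E{x(k) | y(0:k-1)}`. -/
noncomputable def predict (μ : Measure Ω) (x : ℕ → Ω → Idx n → ℝ) (y : ℕ → Ω → Idx p → ℝ)
    (k : ℕ) (ω : Ω) : Idx n → ℝ :=
  fun s => (μ[fun ω' => x k ω' s | obsSigma y (pastSet k)]) ω

/-- The local estimate `x̂^{[1]}(k)`: its block `i` is the conditional expectation of `x_i(k)` given
the measurements up to time `k - 1` available to player `i` at time `k`. -/
noncomputable def localPredict (μ : Measure Ω) (x : ℕ → Ω → Idx n → ℝ)
    (y : ℕ → Ω → Idx p → ℝ) (k : ℕ) (ω : Ω) : Idx n → ℝ :=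
  fun s => (μ[fun ω' => x k ω' s | obsSigma y (localSet s.1 k)]) ω

/-- The prediction error `e(k)`. -/
noncomputable def err (μ : Measure Ω) (x : ℕ → Ω → Idx n → ℝ) (y : ℕ → Ω → Idx p → ℝ)
    (k : ℕ) (ω : Ω) : Idx n → ℝ :=
  x k ω - predict μ x y k ω

/-- The local estimation error `e^{[1]}(k)`. -/
noncomputable def localErr (μ : Measure Ω) (x : ℕ → Ω → Idx n → ℝ) (y : ℕ → Ω → Idx p → ℝ)
    (k : ℕ) (ω : Ω) : Idx n → ℝ :=
  x k ω - localPredict μ x y k ω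

/-- The innovation `ỹ(k) = y(k) - C x̂(k|k-1)`. -/
noncomputable def innov (C : Matrix (Idx p) (Idx n) ℝ) (μ : Measure Ω)
    (x : ℕ → Ω → Idx n → ℝ) (y : ℕ → Ω → Idx p → ℝ) (k : ℕ) (ω : Ω) : Idx p → ℝ :=
  y k ω - C *ᵥ predict μ x y k ω

/-- The local innovation `ỹ^{[1]}(k) = y(k) - C x̂^{[1]}(k)`. -/
noncomputable def localInnov (C : Matrix (Idx p) (Idx n) ℝ) (μ : Measure Ω)
    (x : ℕ → Ω → Idx n → ℝ) (y : ℕ → Ω → Idx p → ℝ) (k : ℕ) (ω : Ω) : Idx p → ℝ :=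
  y k ω - C *ᵥ localPredict μ x y k ω

/-- The prediction error covariance `P(k)`. -/
noncomputable def covP (μ : Measure Ω) (x : ℕ → Ω → Idx n → ℝ) (y : ℕ → Ω → Idx p → ℝ)
    (k : ℕ) : Matrix (Idx n) (Idx n) ℝ :=
  crossMoment μ (err μ x y k) (err μ x y k)

/-- The local estimation error covariance `P^{[1]}(k)`. -/
noncomputable def localCovP (μ : Measure Ω) (x : ℕ → Ω → Idx n → ℝ) (y : ℕ → Ω → Idx p → ℝ)
    (k : ℕ) : Matrix (Idx n) (Idx n) ℝ :=
  crossMoment μ (localErr μ x y k) (localErr μ x y k)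

/-- The innovation covariance `Ỹ(k)`. -/
noncomputable def covY (C : Matrix (Idx p) (Idx n) ℝ) (μ : Measure Ω)
    (x : ℕ → Ω → Idx n → ℝ) (y : ℕ → Ω → Idx p → ℝ) (k : ℕ) : Matrix (Idx p) (Idx p) ℝ :=
  crossMoment μ (innov C μ x y k) (innov C μ x y k)

/-- The local innovation covariance `Ỹ^{[1]}(k)`. -/
noncomputable def localCovY (C : Matrix (Idx p) (Idx n) ℝ) (μ : Measure Ω)
    (x : ℕ → Ω → Idx n → ℝ) (y : ℕ → Ω → Idx p → ℝ) (k : ℕ) : Matrix (Idx p) (Idx p) ℝ :=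
  crossMoment μ (localInnov C μ x y k) (localInnov C μ x y k)

/-- The gain difference `ΔK(k) = K(k) - K^{[1]}(k)`. -/
noncomputable def deltaK {q : Fin 3 → ℕ} (S : System n q p) (μ : Measure Ω)
    (x : ℕ → Ω → Idx n → ℝ) (y : ℕ → Ω → Idx p → ℝ) (k : ℕ) : Matrix (Idx n) (Idx p) ℝ :=
  S.gain (covP μ x y k) - S.localGain (covP μ x y k)

end Estimation

end ThreePlayer

/-! The inputs are removed first. Split the state into its input-free evolution and the contribution
of the inputs. By induction on time, block `i` of the contribution is a function of the measurements
in `localSet i k` (`measurable_sub_freeState`). Hence, for label sets closed under passing to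
earlier times, the outputs with and without inputs generate the same σ-algebra (`obsSigma_eq_free`).
Conditioning on such a set then leaves the contribution of the inputs unchanged, so it cancels from
the estimation errors. What remains is a centred Gaussian family, where conditional expectation is
orthogonal projection (`condExp_eq_of_orthogonal`). The errors are thus linear in the driving
variables before time `k`, although the control laws may be nonlinear.

By time `k + 1` every player knows `y(0:k-1)`, so the full and the local estimates of `x(k+1)` both
extend the common prediction of `x(k)`, each using those components of the innovation `ỹ(k)` that it
sees. For positive definite `V`, each error is therefore `A e(k) + w(k) - L ỹ(k)`, where `L` solves
the normal equations for the visible components (`error_update`): `L = K` in one case and `L =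
K^{[1]}`, row by row, in the other. Subtracting gives `e^{[1]}(k+1) = e(k+1) + ΔK(k) ỹ(k)` almost
surely, and `e(k+1)` is orthogonal to `ỹ(k)`. This yields (a) and (c). Part (b) holds because `v(k)`
is uncorrelated with errors formed before time `k`. -/

namespace ThreePlayer

/-! ### Second moments and projection in `L²`. -/

section SquareIntegrable

variable {Ω : Type*} [MeasurableSpace Ω] {μ : Measure Ω} {ι κ l : Type*}

/-- A random vector with square integrable coordinates. -/
def IsL2 (μ : Measure Ω) (X : Ω → ι → ℝ) : Prop := ∀ a, MemLp (fun ω => X ω a) 2 μ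

lemma IsL2.add {X Y : Ω → ι → ℝ} (hX : IsL2 μ X) (hY : IsL2 μ Y) : IsL2 μ (X + Y) :=
  fun a => (hX a).add (hY a)

lemma IsL2.sub {X Y : Ω → ι → ℝ} (hX : IsL2 μ X) (hY : IsL2 μ Y) : IsL2 μ (X - Y) :=
  fun a => (hX a).sub (hY a)

lemma IsL2.mulVec [Fintype ι] {X : Ω → ι → ℝ} (hX : IsL2 μ X) (M : Matrix κ ι ℝ) :
    IsL2 μ (fun ω => M *ᵥ X ω) :=
  fun a => memLp_finsetSum _ fun b _ => (hX b).const_mul (M a b)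

lemma crossMoment_congr {X X' : Ω → ι → ℝ} {Y Y' : Ω → κ → ℝ}
    (hX : ∀ a, (fun ω => X ω a) =ᵐ[μ] fun ω => X' ω a)
    (hY : ∀ a, (fun ω => Y ω a) =ᵐ[μ] fun ω => Y' ω a) :
    crossMoment μ X Y = crossMoment μ X' Y' := by
  ext a b
  exact integral_congr_ae ((hX a).mul (hY b))

lemma crossMoment_transpose (X : Ω → ι → ℝ) (Y : Ω → κ → ℝ) :
    (crossMoment μ X Y)ᵀ = crossMoment μ Y X := by
  ext a b
  simp [crossMoment, mul_comm]

lemma crossMoment_add_left {X X' : Ω → ι → ℝ} {Y : Ω → κ → ℝ} (hX : IsL2 μ X) (hX' : IsL2 μ X')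
    (hY : IsL2 μ Y) : crossMoment μ (X + X') Y = crossMoment μ X Y + crossMoment μ X' Y := by
  ext a b
  simp only [crossMoment, of_apply, Matrix.add_apply, Pi.add_apply, add_mul]
  exact integral_add ((hX a).integrable_mul (hY b)) ((hX' a).integrable_mul (hY b))

lemma crossMoment_sub_left {X X' : Ω → ι → ℝ} {Y : Ω → κ → ℝ} (hX : IsL2 μ X) (hX' : IsL2 μ X')
    (hY : IsL2 μ Y) : crossMoment μ (X - X') Y = crossMoment μ X Y - crossMoment μ X' Y := by
  ext a b
  simp only [crossMoment, of_apply, Matrix.sub_apply, Pi.sub_apply, sub_mul]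
  exact integral_sub ((hX a).integrable_mul (hY b)) ((hX' a).integrable_mul (hY b))

lemma crossMoment_mulVec_left [Fintype ι] {X : Ω → ι → ℝ} {Y : Ω → κ → ℝ} (hX : IsL2 μ X)
    (hY : IsL2 μ Y) (M : Matrix l ι ℝ) :
    crossMoment μ (fun ω => M *ᵥ X ω) Y = M * crossMoment μ X Y := by
  ext a b
  simp only [crossMoment, of_apply, Matrix.mul_apply, mulVec, dotProduct, Finset.sum_mul, mul_assoc]
  refine (integral_finsetSum (f := fun c ω => M a c * (X ω c * Y ω b)) _ fun c _ =>
    ((hX c).integrable_mul (hY b)).const_mul (M a c)).trans ?_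
  exact Finset.sum_congr rfl fun c _ => integral_const_mul _ _

lemma crossMoment_add_right {X : Ω → ι → ℝ} {Y Y' : Ω → κ → ℝ} (hX : IsL2 μ X) (hY : IsL2 μ Y)
    (hY' : IsL2 μ Y') : crossMoment μ X (Y + Y') = crossMoment μ X Y + crossMoment μ X Y' := by
  rw [← crossMoment_transpose, crossMoment_add_left hY hY' hX, transpose_add,
    crossMoment_transpose, crossMoment_transpose]

lemma crossMoment_mulVec_right [Fintype κ] {X : Ω → ι → ℝ} {Y : Ω → κ → ℝ} (hX : IsL2 μ X)
    (hY : IsL2 μ Y) (M : Matrix l κ ℝ) :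
    crossMoment μ X (fun ω => M *ᵥ Y ω) = crossMoment μ X Y * Mᵀ := by
  rw [← crossMoment_transpose, crossMoment_mulVec_left hY hX, transpose_mul, crossMoment_transpose]

/-- The quadratic form at `c` is the mean of `(cᵀ X)²`. The scalar `cᵀ X` is written with a one-row
matrix so that the bilinearity rules apply. -/
lemma crossMoment_posSemidef [Fintype ι] {X : Ω → ι → ℝ} (hX : IsL2 μ X) :
    (crossMoment μ X X).PosSemidef := by
  refine PosSemidef.of_dotProduct_mulVec_nonneg ?_ fun c => ?_
  · rw [IsHermitian, conjTranspose_eq_transpose_of_trivial, crossMoment_transpose]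
  · have h1 : crossMoment μ (fun ω => replicateRow Unit c *ᵥ X ω)
        (fun ω => replicateRow Unit c *ᵥ X ω) =
        replicateRow Unit c * crossMoment μ X X * (replicateRow Unit c)ᵀ := by
      rw [crossMoment_mulVec_left hX (hX.mulVec _), crossMoment_mulVec_right hX hX, Matrix.mul_assoc]
    have h2 := congrFun (congrFun h1 ()) ()
    have h3 : 0 ≤ crossMoment μ (fun ω => replicateRow Unit c *ᵥ X ω)
        (fun ω => replicateRow Unit c *ᵥ X ω) () () :=
      integral_nonneg fun ω => mul_self_nonneg _
    rw [h2] at h3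
    refine h3.trans_eq ?_
    rw [Matrix.mul_assoc]
    simp [Matrix.mul_apply, dotProduct, mulVec]

/-- Orthogonality to a set of square integrable functions extends to its span. -/
lemma integral_mul_eq_zero_of_mem_span {s : Set (Ω → ℝ)} {f g : Ω → ℝ} (hf : MemLp f 2 μ)
    (hs : ∀ h ∈ s, MemLp h 2 μ ∧ ∫ ω, f ω * h ω ∂μ = 0) (hg : g ∈ Submodule.span ℝ s) :
    MemLp g 2 μ ∧ ∫ ω, f ω * g ω ∂μ = 0 := by
  induction hg using Submodule.span_induction with
  | mem x hx => exact hs x hx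
  | zero => simp
  | add x y _ _ hx hy =>
    refine ⟨hx.1.add hy.1, ?_⟩
    simp only [Pi.add_apply, mul_add]
    refine (integral_add (hf.integrable_mul hx.1) (hf.integrable_mul hy.1)).trans ?_
    exact (congrArg₂ (· + ·) hx.2 hy.2).trans (add_zero 0)
  | smul c x _ hx =>
    refine ⟨hx.1.const_smul c, ?_⟩
    simp only [Pi.smul_apply, smul_eq_mul, mul_left_comm _ c]
    rw [integral_const_mul, hx.2, mul_zero]

/-- Orthogonal projection in `L²` onto the span of finitely many functions. -/
lemma exists_mem_span_orthogonal {s : Set (Ω → ℝ)} (hfin : s.Finite) (hs : ∀ h ∈ s, MemLp h 2 μ)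
    {f : Ω → ℝ} (hf : MemLp f 2 μ) :
    ∃ g ∈ Submodule.span ℝ s, ∀ h ∈ s, ∫ ω, (f ω - g ω) * h ω ∂μ = 0 := by
  have : Finite s := hfin
  let Y : s → Lp ℝ 2 μ := fun h => (hs h h.2).toLp _
  let K : Submodule ℝ (Lp ℝ 2 μ) := Submodule.span ℝ (Set.range Y)
  have : FiniteDimensional ℝ K := FiniteDimensional.span_of_finite ℝ (Set.finite_range Y)
  -- The projection is an almost-everywhere class; this gives a representative that is a genuine
  -- linear combination of functions in `s`, as later measurability arguments need.
  have hlift : ∀ z ∈ K, ∃ g ∈ Submodule.span ℝ s, g =ᵐ[μ] z := by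
    intro z hz
    induction hz using Submodule.span_induction with
    | mem x hx =>
      obtain ⟨h, rfl⟩ := hx
      exact ⟨h, Submodule.subset_span h.2, (MemLp.coeFn_toLp _).symm⟩
    | zero => exact ⟨0, Submodule.zero_mem _, (Lp.coeFn_zero _ _ _).symm⟩
    | add x y _ _ hx hy =>
      obtain ⟨a, ha, ha'⟩ := hx
      obtain ⟨b, hb, hb'⟩ := hy
      exact ⟨a + b, Submodule.add_mem _ ha hb, (ha'.add hb').trans (Lp.coeFn_add x y).symm⟩
    | smul c x _ hx =>
      obtain ⟨a, ha, ha'⟩ := hx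
      exact ⟨c • a, Submodule.smul_mem _ c ha, (ha'.const_smul c).trans (Lp.coeFn_smul c x).symm⟩
  obtain ⟨g, hg, hgz⟩ := hlift _ (K.starProjection_apply_mem (hf.toLp f))
  refine ⟨g, hg, fun h hh => ?_⟩
  have h0 := K.starProjection_inner_eq_zero (hf.toLp f) (Y ⟨h, hh⟩)
    (Submodule.subset_span ⟨_, rfl⟩)
  rw [L2.inner_def] at h0
  rw [← h0]
  refine integral_congr_ae ?_
  filter_upwards [hgz, hf.coeFn_toLp, (hs h hh).coeFn_toLp,
    Lp.coeFn_sub (hf.toLp f) (K.starProjection (hf.toLp f))] with ω h1 h2 h3 h4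
  rw [h4, Pi.sub_apply, h2, ← h1]
  simp only [Y, h3]
  simp [mul_comm]

end SquareIntegrable

/-! ### Conditional expectation in Gaussian families. -/

section Gaussian

variable {Ω : Type*} {T S : Type*}

/-- A member of the span is a continuous linear function of finitely many of the `X t`, and such
functions preserve joint Gaussianity. -/
lemma isGaussianProcess_of_mem_span [MeasurableSpace Ω] {μ : Measure Ω} {X : T → Ω → ℝ} (hX : IsGaussianProcess X μ) {Y : S → Ω → ℝ}
    (hY : ∀ s, Y s ∈ Submodule.span ℝ (Set.range X)) : IsGaussianProcess Y μ := by
  refine hX.of_isGaussianProcess fun s => ?_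
  obtain ⟨c, hc⟩ := (Finsupp.mem_span_range_iff_exists_finsupp).1 (hY s)
  refine ⟨c.support, ∑ i : c.support, c i • ContinuousLinearMap.proj i, fun ω => ?_⟩
  rw [← hc, Finsupp.sum, Finset.sum_apply]
  simp only [_root_.sum_apply]
  exact (Finset.sum_coe_sort c.support fun i => c i * X i ω).symm

/-- The conditional expectation within a centred Gaussian family is the orthogonal projection. -/
lemma condExp_eq_of_orthogonal {m m0 : MeasurableSpace Ω} {μ : Measure Ω} {X : T → Ω → ℝ}
    (hX : IsGaussianProcess X μ)
    (hmeas : ∀ t, Measurable (X t)) (h0 : ∀ t, ∫ ω, X t ω ∂μ = 0) {Y : S → Ω → ℝ} {f g : Ω → ℝ}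
    (hm : m = MeasurableSpace.comap (fun ω s => Y s ω) MeasurableSpace.pi)
    (hY : ∀ s, Y s ∈ Submodule.span ℝ (Set.range X)) (hf : f ∈ Submodule.span ℝ (Set.range X))
    (hg : g ∈ Submodule.span ℝ (Set.range Y)) (horth : ∀ s, ∫ ω, (f ω - g ω) * Y s ω ∂μ = 0) :
    μ[f | m] =ᵐ[μ] g := by
  have := hX.isProbabilityMeasure
  have hprop : ∀ h ∈ Submodule.span ℝ (Set.range X),
      Measurable h ∧ MemLp h 2 μ ∧ ∫ ω, h ω ∂μ = 0 := by
    intro h hh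
    -- Orthogonality to the constant 1 is the same as having mean zero, so the mean condition passes
    -- to the span.
    have h1 := integral_mul_eq_zero_of_mem_span (μ := μ) (f := fun _ => 1) (memLp_const 1)
      (s := Set.range X) (by
        rintro _ ⟨t, rfl⟩
        exact ⟨(hX.hasGaussianLaw_eval t).memLp_two, by simpa using h0 t⟩) hh
    refine ⟨?_, h1.1, by simpa using h1.2⟩
    clear h1
    induction hh using Submodule.span_induction with
    | mem x hx => obtain ⟨t, rfl⟩ := hx; exact hmeas t
    | zero => exact measurable_zero
    | add x y _ _ hx hy => exact hx.add hy
    | smul c x _ hx => exact hx.const_smul c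
  have hgX : g ∈ Submodule.span ℝ (Set.range X) :=
    Submodule.span_le.2 (by rintro _ ⟨s, rfl⟩; exact hY s) hg
  have hfg := Submodule.sub_mem _ hf hgX
  have hmle : m ≤ m0 := by
    rw [hm]
    exact (measurable_pi_iff.2 fun s => (hprop _ (hY s)).1).comap_le
  have hgm : Measurable[m] g := by
    have hYm : ∀ s, Measurable[m] (Y s) := fun s => by
      rw [hm]
      exact (measurable_pi_apply s).comp (comap_measurable fun ω s => Y s ω)
    clear horth hgX hfg
    induction hg using Submodule.span_induction with
    | mem x hx => obtain ⟨t, rfl⟩ := hx; exact hYm t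
    | zero => exact @measurable_const _ _ _ m 0
    | add x y _ _ hx hy => exact hx.add hy
    | smul c x _ hx => exact hx.const_smul c
  -- For jointly Gaussian families zero covariance gives independence; the residual then has
  -- conditional expectation equal to its mean, which is 0.
  have hind : IndepFun (fun ω (_ : Unit) => (f - g) ω) (fun ω s => Y s ω) μ := by
    refine IsGaussianProcess.indepFun_of_covariance_eq_zero (X := fun _ : Unit => f - g)
      (isGaussianProcess_of_mem_span hX ?_) (fun _ => (hprop _ hfg).1.aemeasurable)
      (fun s => (hprop _ (hY s)).1.aemeasurable) fun _ s => ?_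
    · rintro (_ | s)
      exacts [hfg, hY s]
    · rw [covariance_eq_sub (hprop _ hfg).2.1 (hprop _ (hY s)).2.1, (hprop _ (hY s)).2.2, mul_zero,
        sub_zero]
      exact horth s
  have hind' : Indep (MeasurableSpace.comap (f - g) inferInstance) m μ := by
    rw [hm]
    exact (hind.comp (measurable_pi_apply ()) measurable_id)
  have hcond : μ[f - g | m] =ᵐ[μ] fun _ => ∫ ω, (f - g) ω ∂μ :=
    condExp_indep_eq ((hprop _ hfg).1.comap_le) hmle
      (comap_measurable (f - g)).stronglyMeasurable hind'
  have hfi : Integrable f μ := (hprop _ hf).2.1.integrable one_le_two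
  have hgi : Integrable g μ := (hprop _ hgX).2.1.integrable one_le_two
  have hsub := condExp_sub hfi hgi m
  rw [condExp_of_stronglyMeasurable hmle hgm.stronglyMeasurable hgi] at hsub
  rw [(hprop _ hfg).2.2] at hcond
  filter_upwards [hcond, hsub] with ω h1 h2
  rw [h1, Pi.sub_apply] at h2
  linarith

end Gaussian

end ThreePlayer
namespace ThreePlayer

/-! ### Information patterns and the σ-algebras they generate. -/

section Measurements

variable {Ω : Type*} {n q p : Fin 3 → ℕ}

/-- The scalar measurements with labels in `T`. -/
def obsFun (y : ℕ → Ω → Idx p → ℝ) (T : Set (Fin 3 × ℕ)) :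
    ((s : T) × Fin (p s.1.1)) → Ω → ℝ :=
  fun s ω => y s.1.1.2 ω ⟨s.1.1.1, s.2⟩

lemma obsSigma_le {y : ℕ → Ω → Idx p → ℝ} {T : Set (Fin 3 × ℕ)} {m : MeasurableSpace Ω}
    (h : ∀ j t, (j, t) ∈ T → ∀ a, Measurable[m] fun ω => y t ω ⟨j, a⟩) : obsSigma y T ≤ m := by
  refine Measurable.comap_le ?_
  exact measurable_pi_iff.2 fun s => measurable_pi_iff.2 fun a => h s.1.1 s.1.2 s.2 a

lemma measurable_obsSigma (y : ℕ → Ω → Idx p → ℝ) {T : Set (Fin 3 × ℕ)} {j : Fin 3} {t : ℕ}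
    (h : (j, t) ∈ T) (a : Fin (p j)) : Measurable[obsSigma y T] fun ω => y t ω ⟨j, a⟩ :=
  (measurable_pi_apply a).comp
    ((measurable_pi_apply (⟨(j, t), h⟩ : T)).comp (comap_measurable (obs y T)))

lemma comap_pi_le {ι : Type*} {Y : ι → Ω → ℝ} {m : MeasurableSpace Ω}
    (h : ∀ s, Measurable[m] (Y s)) :
    MeasurableSpace.comap (fun ω s => Y s ω) MeasurableSpace.pi ≤ m :=
  (measurable_pi_iff.2 h).comap_le

lemma obsSigma_eq (y : ℕ → Ω → Idx p → ℝ) (T : Set (Fin 3 × ℕ)) :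
    obsSigma y T = MeasurableSpace.comap (fun ω s => obsFun y T s ω) MeasurableSpace.pi := by
  refine le_antisymm (obsSigma_le fun j t h a => ?_)
    (comap_pi_le fun s => measurable_obsSigma y s.1.2 s.2)
  exact (measurable_pi_apply (⟨⟨(j, t), h⟩, a⟩ : (s : T) × Fin (p s.1.1))).comp
    (comap_measurable fun ω s => obsFun y T s ω)

lemma obsSigma_mono (y : ℕ → Ω → Idx p → ℝ) {T T' : Set (Fin 3 × ℕ)} (h : T ⊆ T') :
    obsSigma y T ≤ obsSigma y T' :=
  obsSigma_le fun _ _ ht => measurable_obsSigma y (h ht)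

lemma pastSet_mono {k l : ℕ} (h : k ≤ l) : pastSet k ⊆ pastSet l :=
  fun _ hs => lt_of_lt_of_le hs h

lemma delay_le_two (i j : Fin 3) : delay i j ≤ 2 := by
  revert i j; decide

lemma localSet_subset_pastSet (i : Fin 3) (k : ℕ) : localSet i k ⊆ pastSet k :=
  Set.inter_subset_right

/-- A measurement taken by time `k - 1` reaches everyone by `k + 1`, since no delay exceeds 2. This
is why the local estimates share the full past up to `k - 1`. -/
lemma pastSet_subset_localSet_succ (i : Fin 3) (k : ℕ) : pastSet k ⊆ localSet i (k + 1) := by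
  intro s hs
  have hs' : s.2 < k := hs
  have := delay_le_two s.1 i
  exact ⟨show s.2 + delay s.1 i ≤ k + 1 by omega, show s.2 < k + 1 by omega⟩

/-- Ensures that player `i` can account for its own input `u_i(k)` when estimating `x_i(k+1)`. -/
lemma infoSet_subset_localSet_succ (i : Fin 3) (k : ℕ) : infoSet i k ⊆ localSet i (k + 1) := by
  intro s hs
  have hs' : s.2 + delay s.1 i ≤ k := hs
  exact ⟨show s.2 + delay s.1 i ≤ k + 1 by omega, show s.2 < k + 1 by omega⟩

lemma mem_localSet_succ_iff {i j : Fin 3} {k : ℕ} : (j, k) ∈ localSet i (k + 1) ↔ System.near i j := by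
  constructor
  · rintro ⟨h, _⟩
    have h' : k + delay j i ≤ k + 1 := h
    show delay j i ≤ 1
    omega
  · intro h
    have h' : delay j i ≤ 1 := h
    exact ⟨show k + delay j i ≤ k + 1 by omega, Nat.lt_succ_self k⟩

lemma finite_pastSet (k : ℕ) : (pastSet k).Finite := by
  refine (Set.finite_univ.prod (Set.finite_lt_nat k)).subset fun s hs => ⟨Set.mem_univ _, hs⟩

/-- Sets of labels which contain, along with a measurement, all strictly earlier measurements. -/
def IsClosedInTime (T : Set (Fin 3 × ℕ)) : Prop := ∀ s ∈ T, pastSet s.2 ⊆ T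

lemma isClosedInTime_pastSet (k : ℕ) : IsClosedInTime (pastSet k) :=
  fun _ hs => pastSet_mono (le_of_lt hs)

/-- Labels in `localSet i k` have time at most `k - 1`, so anything strictly earlier is at least two
steps old at time `k`, the largest delay. -/
lemma isClosedInTime_localSet (i : Fin 3) (k : ℕ) : IsClosedInTime (localSet i k) := by
  intro s hs r hr
  have h1 : s.2 < k := hs.2
  have h2 : r.2 < s.2 := hr
  have := delay_le_two r.1 i
  exact ⟨show r.2 + delay r.1 i ≤ k by omega, show r.2 < k by omega⟩

lemma span_obsFun_mono (y : ℕ → Ω → Idx p → ℝ) {T T' : Set (Fin 3 × ℕ)} (h : T ⊆ T') :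
    Submodule.span ℝ (Set.range (obsFun y T)) ≤ Submodule.span ℝ (Set.range (obsFun y T')) := by
  refine Submodule.span_mono ?_
  rintro _ ⟨⟨s, a⟩, rfl⟩
  exact ⟨⟨⟨s.1, h s.2⟩, a⟩, rfl⟩

lemma mem_span_obsFun (y : ℕ → Ω → Idx p → ℝ) {T : Set (Fin 3 × ℕ)} {c : Idx p} {t : ℕ}
    (h : (c.1, t) ∈ T) : (fun ω => y t ω c) ∈ Submodule.span ℝ (Set.range (obsFun y T)) :=
  Submodule.subset_span ⟨⟨⟨(c.1, t), h⟩, c.2⟩, rfl⟩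

/-- Only coordinates with nonzero coefficient need to lie in `N`; this is how the zero blocks of the
local gain restrict it to visible measurements. -/
lemma mulVec_mem {ι κ : Type*} [Fintype ι] {N : Submodule ℝ (Ω → ℝ)} {X : Ω → ι → ℝ}
    (M : Matrix κ ι ℝ) (a : κ) (hX : ∀ c, M a c ≠ 0 → (fun ω => X ω c) ∈ N) :
    (fun ω => (M *ᵥ X ω) a) ∈ N := by
  have h : (fun ω => (M *ᵥ X ω) a) = ∑ c, M a c • fun ω => X ω c := by
    ext ω
    simp [mulVec, dotProduct]
  rw [h]
  refine Submodule.sum_mem _ fun c _ => ?_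
  by_cases hc : M a c = 0
  · rw [hc, zero_smul]
    exact N.zero_mem
  · exact N.smul_mem _ (hX c hc)

lemma measurable_mulVec {ι κ : Type*} [Fintype ι] {m : MeasurableSpace Ω} {X : Ω → ι → ℝ}
    (M : Matrix κ ι ℝ) (a : κ) (hX : ∀ c, M a c ≠ 0 → Measurable fun ω => X ω c) :
    Measurable fun ω => (M *ᵥ X ω) a := by
  simp only [mulVec, dotProduct]
  refine Finset.measurable_sum _ fun c _ => ?_
  by_cases hc : M a c = 0
  · simp only [hc, zero_mul]
    exact measurable_const
  · exact (hX c hc).const_mul _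

/-- The span of the driving variables which act before time `k`. -/
def driveSpan (x₀ : Ω → Idx n → ℝ) (w : ℕ → Ω → Idx n → ℝ) (v : ℕ → Ω → Idx p → ℝ) (k : ℕ) :
    Submodule ℝ (Ω → ℝ) :=
  Submodule.span ℝ ({f | ∃ a, f = fun ω => x₀ ω a} ∪
    ({f | ∃ t < k, ∃ a, f = fun ω => w t ω a} ∪ {f | ∃ t < k, ∃ b, f = fun ω => v t ω b}))

lemma driveSpan_mono (x₀ : Ω → Idx n → ℝ) (w : ℕ → Ω → Idx n → ℝ) (v : ℕ → Ω → Idx p → ℝ)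
    {k l : ℕ} (h : k ≤ l) : driveSpan x₀ w v k ≤ driveSpan x₀ w v l := by
  refine Submodule.span_mono (Set.union_subset_union_right _ (Set.union_subset_union ?_ ?_))
  · rintro _ ⟨t, ht, a, rfl⟩
    exact ⟨t, ht.trans_le h, a, rfl⟩
  · rintro _ ⟨t, ht, a, rfl⟩
    exact ⟨t, ht.trans_le h, a, rfl⟩

lemma driveSpan_le_span_driving (x₀ : Ω → Idx n → ℝ) (w : ℕ → Ω → Idx n → ℝ)
    (v : ℕ → Ω → Idx p → ℝ) (k : ℕ) :
    driveSpan x₀ w v k ≤ Submodule.span ℝ (Set.range (driving x₀ w v)) := by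
  refine Submodule.span_mono ?_
  rintro _ (⟨a, rfl⟩ | ⟨t, _, a, rfl⟩ | ⟨t, _, a, rfl⟩)
  exacts [⟨.inl a, rfl⟩, ⟨.inr (.inl (t, a)), rfl⟩, ⟨.inr (.inr (t, a)), rfl⟩]

/-! ### The system without inputs. -/

namespace System

/-- The state of the system without inputs. -/
def freeState (S : System n q p) (x₀ : Ω → Idx n → ℝ) (w : ℕ → Ω → Idx n → ℝ) :
    ℕ → Ω → Idx n → ℝ
  | 0, ω => x₀ ω
  | k + 1, ω => S.matA *ᵥ S.freeState x₀ w k ω + w k ω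

/-- The output of the system without inputs. -/
def freeOutput (S : System n q p) (x₀ : Ω → Idx n → ℝ) (w : ℕ → Ω → Idx n → ℝ)
    (v : ℕ → Ω → Idx p → ℝ) (k : ℕ) (ω : Ω) : Idx p → ℝ :=
  S.matC *ᵥ S.freeState x₀ w k ω + v k ω

variable (S : System n q p) (x₀ : Ω → Idx n → ℝ) (w : ℕ → Ω → Idx n → ℝ) (v : ℕ → Ω → Idx p → ℝ)

lemma freeState_mem (k : ℕ) (a : Idx n) :
    (fun ω => S.freeState x₀ w k ω a) ∈ driveSpan x₀ w v k := by
  induction k generalizing a with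
  | zero => exact Submodule.subset_span (.inl ⟨a, rfl⟩)
  | succ k ih =>
    refine Submodule.add_mem _ (mulVec_mem S.matA a fun c _ =>
      driveSpan_mono x₀ w v k.le_succ (ih c)) ?_
    exact Submodule.subset_span (.inr (.inl ⟨k, k.lt_succ_self, a, rfl⟩))

lemma freeOutput_mem {k t : ℕ} (h : t < k) (b : Idx p) :
    (fun ω => S.freeOutput x₀ w v t ω b) ∈ driveSpan x₀ w v k := by
  refine Submodule.add_mem _ (mulVec_mem S.matC b fun c _ =>
      driveSpan_mono x₀ w v h.le (S.freeState_mem x₀ w v t c)) ?_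
  exact Submodule.subset_span (.inr (.inr ⟨t, h, b, rfl⟩))

lemma span_obsFun_freeOutput_le {T : Set (Fin 3 × ℕ)} {k : ℕ} (hT : T ⊆ pastSet k) :
    Submodule.span ℝ (Set.range (obsFun (S.freeOutput x₀ w v) T)) ≤ driveSpan x₀ w v k := by
  refine Submodule.span_le.2 ?_
  rintro _ ⟨s, rfl⟩
  exact S.freeOutput_mem x₀ w v (hT s.1.2) _

end System

end Measurements

/-! ### Separation of control from estimation. -/

namespace System.IsClosedLoop

variable {Ω : Type*} [mΩ : MeasurableSpace Ω] {μ : Measure Ω} {n q p : Fin 3 → ℕ}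
  {S : System n q p} {x : ℕ → Ω → Idx n → ℝ} {u : ℕ → Ω → Idx q → ℝ} {y : ℕ → Ω → Idx p → ℝ}
  {w : ℕ → Ω → Idx n → ℝ} {v : ℕ → Ω → Idx p → ℝ}

lemma measurable_control (h : S.IsClosedLoop μ x u y w v) (i : Fin 3) (k : ℕ) (a : Fin (q i)) :
    Measurable[obsSigma y (infoSet i k)] fun ω => u k ω ⟨i, a⟩ := by
  obtain ⟨γ, hγ, hu⟩ := h.control i k
  simp only [hu]
  exact (measurable_pi_apply a).comp (hγ.comp (comap_measurable (obs y (infoSet i k))))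

/-- The contribution of the inputs to the state. -/
lemma sub_freeState_succ (h : S.IsClosedLoop μ x u y w v) (k : ℕ) (ω : Ω) :
    x (k + 1) ω - S.freeState (x 0) w (k + 1) ω =
      S.matA *ᵥ (x k ω - S.freeState (x 0) w k ω) + S.matB *ᵥ u k ω := by
  rw [h.state, freeState, mulVec_sub]
  abel

/-- The contribution of the inputs satisfies `d(k+1) = A d(k) + B u(k)`. All blocks of `d(k)` depend
on measurements before `k`, which every player has by `k + 1`. Block diagonality of `B` admits only
`u_i(k)` into block `i`, and player `i` knows its arguments. -/
lemma measurable_sub_freeState (h : S.IsClosedLoop μ x u y w v) (k : ℕ) (a : Idx n) :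
    Measurable[obsSigma y (localSet a.1 k)] fun ω => (x k ω - S.freeState (x 0) w k ω) a := by
  induction k generalizing a with
  | zero =>
    simp only [freeState, sub_self]
    exact @measurable_const _ _ _ (obsSigma y (localSet a.1 0)) 0
  | succ k ih =>
    simp only [h.sub_freeState_succ]
    refine Measurable.add (measurable_mulVec S.matA a fun c _ => ?_)
      (measurable_mulVec S.matB a fun c hc => ?_)
    · exact (ih c).mono (obsSigma_mono y ((localSet_subset_pastSet _ _).trans
        (pastSet_subset_localSet_succ _ _))) le_rfl
    · obtain ⟨i, a⟩ := a
      obtain ⟨j, c⟩ := c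
      have hij : i = j := by
        by_contra hij
        exact hc (blockDiagonal'_apply_ne S.B _ _ hij)
      subst hij
      exact (h.measurable_control i k c).mono
        (obsSigma_mono y (infoSet_subset_localSet_succ _ _)) le_rfl

lemma output_eq (h : S.IsClosedLoop μ x u y w v) (k : ℕ) (ω : Ω) :
    y k ω = S.freeOutput (x 0) w v k ω + S.matC *ᵥ (x k ω - S.freeState (x 0) w k ω) := by
  rw [h.output, freeOutput, mulVec_sub]
  abel

lemma measurable_sub_freeState_past (h : S.IsClosedLoop μ x u y w v) (k : ℕ) (a : Idx n) :
    Measurable[obsSigma y (pastSet k)] fun ω => (x k ω - S.freeState (x 0) w k ω) a :=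
  (h.measurable_sub_freeState k a).mono (obsSigma_mono y (localSet_subset_pastSet _ _)) le_rfl

/-- Each output is the free output plus a function of strictly earlier outputs, so the true outputs
are recovered recursively from the free ones. -/
lemma obsSigma_pastSet_le (h : S.IsClosedLoop μ x u y w v) (k : ℕ) :
    obsSigma y (pastSet k) ≤ obsSigma (S.freeOutput (x 0) w v) (pastSet k) := by
  induction k using Nat.strong_induction_on with
  | _ k ih =>
    refine obsSigma_le fun j t ht a => ?_
    simp only [h.output_eq]
    refine (measurable_obsSigma (S.freeOutput (x 0) w v) ht a).add
      (measurable_mulVec S.matC _ fun c _ => ?_)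
    exact (h.measurable_sub_freeState_past t c).mono
      ((ih t ht).trans (obsSigma_mono _ (pastSet_mono (le_of_lt ht)))) le_rfl

/-- The inputs do not change the information. -/
lemma obsSigma_eq_free (h : S.IsClosedLoop μ x u y w v) {T : Set (Fin 3 × ℕ)}
    (hT : IsClosedInTime T) : obsSigma y T = obsSigma (S.freeOutput (x 0) w v) T := by
  -- In both directions the correction at time `t` depends on outputs before `t`, and closedness in
  -- time puts those labels in `T`.
  apply le_antisymm
  · refine obsSigma_le fun j t ht a => ?_
    simp only [h.output_eq]
    refine (measurable_obsSigma (S.freeOutput (x 0) w v) ht a).add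
      (measurable_mulVec S.matC _ fun c _ => ?_)
    exact (h.measurable_sub_freeState_past t c).mono
      ((h.obsSigma_pastSet_le t).trans (obsSigma_mono _ (hT _ ht))) le_rfl
  · refine obsSigma_le fun j t ht a => ?_
    have hy : ∀ ω, S.freeOutput (x 0) w v t ω ⟨j, a⟩ =
        y t ω ⟨j, a⟩ - (S.matC *ᵥ (x t ω - S.freeState (x 0) w t ω)) ⟨j, a⟩ := by
      intro ω
      rw [h.output_eq t ω, Pi.add_apply, add_sub_cancel_right]
    simp only [hy]
    refine (measurable_obsSigma y ht a).sub (measurable_mulVec S.matC _ fun c _ => ?_)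
    exact (h.measurable_sub_freeState_past t c).mono (obsSigma_mono _ (hT _ ht)) le_rfl

lemma measurable_of_mem (h : S.IsClosedLoop μ x u y w v) {f : Ω → ℝ}
    (hf : f ∈ Submodule.span ℝ (Set.range (driving (x 0) w v))) : Measurable f := by
  induction hf using Submodule.span_induction with
  | mem x hx => obtain ⟨t, rfl⟩ := hx; exact h.measurable_driving t
  | zero => exact measurable_const
  | add x y _ _ hx hy => exact hx.add hy
  | smul c x _ hx => exact hx.const_smul c

lemma memLp_of_mem (h : S.IsClosedLoop μ x u y w v) {f : Ω → ℝ}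
    (hf : f ∈ Submodule.span ℝ (Set.range (driving (x 0) w v))) :
    MemLp f 2 μ ∧ ∫ ω, f ω ∂μ = 0 := by
  have := h.gaussian.isProbabilityMeasure
  have h1 := integral_mul_eq_zero_of_mem_span (μ := μ) (f := fun _ => 1) (memLp_const 1)
    (s := Set.range (driving (x 0) w v)) (by
      rintro _ ⟨t, rfl⟩
      exact ⟨(h.gaussian.hasGaussianLaw_eval t).memLp_two, by simpa using h.mean_zero t⟩) hf
  exact ⟨h1.1, by simpa using h1.2⟩

lemma memLp_of_mem_driveSpan (h : S.IsClosedLoop μ x u y w v) {k : ℕ} {f : Ω → ℝ}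
    (hf : f ∈ driveSpan (x 0) w v k) : MemLp f 2 μ ∧ ∫ ω, f ω ∂μ = 0 :=
  h.memLp_of_mem (driveSpan_le_span_driving _ _ _ _ hf)

lemma isL2_w (h : S.IsClosedLoop μ x u y w v) (k : ℕ) : IsL2 μ (w k) := fun a =>
  (h.memLp_of_mem (Submodule.subset_span ⟨.inr (.inl (k, a)), rfl⟩)).1

lemma isL2_v (h : S.IsClosedLoop μ x u y w v) (k : ℕ) : IsL2 μ (v k) := fun a =>
  (h.memLp_of_mem (Submodule.subset_span ⟨.inr (.inr (k, a)), rfl⟩)).1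

lemma integral_v (h : S.IsClosedLoop μ x u y w v) (k : ℕ) (a : Idx p) : ∫ ω, v k ω a ∂μ = 0 :=
  h.mean_zero (.inr (.inr (k, a)))

/-- The noises at time `k` are uncorrelated with everything that happened before. -/
lemma integral_w_mul (h : S.IsClosedLoop μ x u y w v) {k : ℕ} {f : Ω → ℝ}
    (hf : f ∈ driveSpan (x 0) w v k) (a : Idx n) : ∫ ω, w k ω a * f ω ∂μ = 0 := by
  refine (integral_mul_eq_zero_of_mem_span (h.isL2_w k a) (fun g hg => ?_) hf).2
  refine ⟨(h.memLp_of_mem_driveSpan (Submodule.subset_span hg)).1, ?_⟩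
  rcases hg with ⟨b, rfl⟩ | ⟨t, ht, b, rfl⟩ | ⟨t, ht, b, rfl⟩
  · simpa only [mul_comm] using h.cov_init_w k b a
  · rw [h.cov_w, if_neg ht.ne']
  · exact h.cov_w_v k t a b

lemma integral_v_mul (h : S.IsClosedLoop μ x u y w v) {k : ℕ} {f : Ω → ℝ}
    (hf : f ∈ driveSpan (x 0) w v k) (a : Idx p) : ∫ ω, v k ω a * f ω ∂μ = 0 := by
  refine (integral_mul_eq_zero_of_mem_span (h.isL2_v k a) (fun g hg => ?_) hf).2
  refine ⟨(h.memLp_of_mem_driveSpan (Submodule.subset_span hg)).1, ?_⟩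
  rcases hg with ⟨b, rfl⟩ | ⟨t, ht, b, rfl⟩ | ⟨t, ht, b, rfl⟩
  · simpa only [mul_comm] using h.cov_init_v k b a
  · simpa only [mul_comm] using h.cov_w_v t k b a
  · rw [h.cov_v, if_neg ht.ne']

/-- The inputs are only assumed integrable, so square integrability is obtained for the errors and
not for the state. -/
lemma integrable_state (h : S.IsClosedLoop μ x u y w v) (k : ℕ) (a : Idx n) :
    Integrable (fun ω => x k ω a) μ := by
  have := h.gaussian.isProbabilityMeasure
  induction k generalizing a with
  | zero =>
    exact (h.memLp_of_mem (Submodule.subset_span ⟨.inl a, rfl⟩)).1.integrable one_le_two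
  | succ k ih =>
    simp only [h.state, Pi.add_apply, mulVec, dotProduct]
    exact ((integrable_finsetSum _ fun c _ => (ih c).const_mul _).add
      (integrable_finsetSum _ fun c _ => (h.control_integrable k c).const_mul _)).add
      ((h.isL2_w k a).integrable one_le_two)

lemma obsSigma_le_of_isClosedInTime (h : S.IsClosedLoop μ x u y w v) {T : Set (Fin 3 × ℕ)}
    (hT : IsClosedInTime T) : obsSigma y T ≤ mΩ := by
  rw [h.obsSigma_eq_free hT]
  exact obsSigma_le fun j t _ a => h.measurable_of_mem
    (driveSpan_le_span_driving _ _ _ _ (S.freeOutput_mem (x 0) w v t.lt_succ_self ⟨j, a⟩))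

/-- The estimation error is the residual of a linear regression on the uncontrolled outputs. -/
lemma sub_condExp_eq (h : S.IsClosedLoop μ x u y w v) {T : Set (Fin 3 × ℕ)} {k : ℕ}
    (hT : IsClosedInTime T) {a : Idx n} (haT : localSet a.1 k ⊆ T) {g : Ω → ℝ}
    (hg : g ∈ Submodule.span ℝ (Set.range (obsFun (S.freeOutput (x 0) w v) T)))
    (horth : ∀ s, ∫ ω, (S.freeState (x 0) w k ω a - g ω) *
      obsFun (S.freeOutput (x 0) w v) T s ω ∂μ = 0) :
    (fun ω => x k ω a - (μ[fun ω' => x k ω' a | obsSigma y T]) ω) =ᵐ[μ]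
      fun ω => S.freeState (x 0) w k ω a - g ω := by
  have := h.gaussian.isProbabilityMeasure
  have hfree : (fun ω => S.freeState (x 0) w k ω a) ∈
      Submodule.span ℝ (Set.range (driving (x 0) w v)) :=
    driveSpan_le_span_driving _ _ _ _ (S.freeState_mem (x 0) w v k a)
  have h1 : μ[fun ω => S.freeState (x 0) w k ω a | obsSigma y T] =ᵐ[μ] g := by
    refine condExp_eq_of_orthogonal h.gaussian h.measurable_driving h.mean_zero
      ((h.obsSigma_eq_free hT).trans (obsSigma_eq _ _)) (fun s => ?_) hfree hg horth
    exact driveSpan_le_span_driving _ _ _ _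
      (S.freeOutput_mem (x 0) w v s.1.1.2.lt_succ_self ⟨s.1.1.1, s.2⟩)
  have hi : Integrable (fun ω => S.freeState (x 0) w k ω a) μ :=
    (h.memLp_of_mem hfree).1.integrable one_le_two
  -- The contribution of the inputs is known given `T`, so it equals its own conditional expectation
  -- and drops out of the error.
  have hm : Measurable[obsSigma y T] fun ω => (x k ω - S.freeState (x 0) w k ω) a :=
    (h.measurable_sub_freeState k a).mono (obsSigma_mono y haT) le_rfl
  have h2 := condExp_sub (h.integrable_state k a) hi (obsSigma y T)
  have h3 : μ[(fun ω => x k ω a) - fun ω => S.freeState (x 0) w k ω a | obsSigma y T] =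
      fun ω => (x k ω - S.freeState (x 0) w k ω) a :=
    condExp_of_stronglyMeasurable (h.obsSigma_le_of_isClosedInTime hT) hm.stronglyMeasurable
      ((h.integrable_state k a).sub hi)
  rw [h3] at h2
  filter_upwards [h1, h2] with ω h4 h5
  simp only [Pi.sub_apply, h4] at h5
  linarith

lemma exists_regression (h : S.IsClosedLoop μ x u y w v) {T : Set (Fin 3 × ℕ)} (hT : T.Finite)
    (k : ℕ) (a : Idx n) :
    ∃ g ∈ Submodule.span ℝ (Set.range (obsFun (S.freeOutput (x 0) w v) T)),
      ∀ s, ∫ ω, (S.freeState (x 0) w k ω a - g ω) *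
        obsFun (S.freeOutput (x 0) w v) T s ω ∂μ = 0 := by
  have : Finite T := hT
  obtain ⟨g, hg, hg'⟩ := exists_mem_span_orthogonal (μ := μ)
    (Set.finite_range (obsFun (S.freeOutput (x 0) w v) T)) (by
      rintro _ ⟨s, rfl⟩
      exact (h.memLp_of_mem_driveSpan
        (S.freeOutput_mem (x 0) w v s.1.1.2.lt_succ_self ⟨s.1.1.1, s.2⟩)).1)
    (h.memLp_of_mem_driveSpan (S.freeState_mem (x 0) w v k a)).1
  exact ⟨g, hg, fun s => hg' _ ⟨s, rfl⟩⟩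

/-- Placing the error in `driveSpan` makes it centred, square integrable and uncorrelated with the
noises at time `k`. -/
lemma exists_sub_condExp_eq (h : S.IsClosedLoop μ x u y w v) {T : Set (Fin 3 × ℕ)} {k : ℕ}
    (hT : IsClosedInTime T) (hTk : T ⊆ pastSet k) {a : Idx n} (haT : localSet a.1 k ⊆ T) :
    ∃ r ∈ driveSpan (x 0) w v k,
      (fun ω => x k ω a - (μ[fun ω' => x k ω' a | obsSigma y T]) ω) =ᵐ[μ] r := by
  obtain ⟨g, hg, horth⟩ := h.exists_regression ((finite_pastSet k).subset hTk) k a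
  exact ⟨_, Submodule.sub_mem _ (S.freeState_mem (x 0) w v k a)
    (S.span_obsFun_freeOutput_le (x 0) w v hTk hg), h.sub_condExp_eq hT haT hg horth⟩

end System.IsClosedLoop
end ThreePlayer
namespace ThreePlayer

/-! ### The gains as solutions of normal equations. -/

namespace System

variable {n q p : Fin 3 → ℕ} (S : System n q p)

lemma matC_apply_of_ne {b : Idx p} {c : Idx n} (h : b.1 ≠ c.1) : S.matC b c = 0 :=
  blockDiagonal'_apply_ne S.C _ _ h

lemma sum_near {d : Fin 3 → ℕ} (i : Fin 3) {f : Idx d → ℝ} (hf : ∀ c, ¬ near i c.1 → f c = 0) :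
    ∑ c : {c : Idx d // near i c.1}, f c = ∑ c, f c := by
  have h0 : ∑ c : {c : Idx d // ¬ near i c.1}, f c = 0 :=
    Finset.sum_eq_zero fun c _ => hf c.1 c.2
  rw [← Fintype.sum_subtype_add_sum_subtype (fun c : Idx d => near i c.1) f, h0, add_zero]

/-- The inclusion of the coordinates of the blocks in `S_i`. -/
abbrev nearIncl (d : Fin 3 → ℕ) (i : Fin 3) : {c : Idx d // near i c.1} → Idx d := Subtype.val

/-- Multiplication by `Cᵀ` respects the restriction to the blocks in `S_i`. -/
lemma submatrix_mul_matC_transpose {l k : Type*} (M : Matrix l (Idx n) ℝ) (f : k → l) (i : Fin 3) :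
    M.submatrix f (nearIncl n i) *
      (S.matC.submatrix (nearIncl p i) (nearIncl n i))ᵀ =
      (M * S.matCᵀ).submatrix f (nearIncl p i) := by
  ext a b
  simp only [Matrix.mul_apply, submatrix_apply, transpose_apply]
  refine sum_near i (f := fun c => M (f a) c * S.matC b.1 c) fun c hc => ?_
  rw [S.matC_apply_of_ne, mul_zero]
  intro hb
  exact hc (hb ▸ b.2)

lemma matC_submatrix_mul {l k : Type*} (M : Matrix (Idx n) l ℝ) (f : k → l) (i : Fin 3) :
    S.matC.submatrix (nearIncl p i) (nearIncl n i) * M.submatrix (nearIncl n i) f =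
      (S.matC * M).submatrix (nearIncl p i) f := by
  ext a b
  simp only [Matrix.mul_apply, submatrix_apply]
  refine sum_near i (f := fun c => S.matC a.1 c * M c (f b)) fun c hc => ?_
  rw [S.matC_apply_of_ne, zero_mul]
  intro ha
  exact hc (ha ▸ a.2)

lemma posDef_innovation (hV : S.V.PosDef) {P : Matrix (Idx n) (Idx n) ℝ} (hP : P.PosSemidef) :
    (S.matC * P * S.matCᵀ + S.V).PosDef := by
  have h := hP.mul_mul_conjTranspose_same S.matC
  rw [conjTranspose_eq_transpose_of_trivial] at h
  exact PosDef.posSemidef_add h hV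

lemma gain_mul (hV : S.V.PosDef) {P : Matrix (Idx n) (Idx n) ℝ} (hP : P.PosSemidef) :
    S.gain P * (S.matC * P * S.matCᵀ + S.V) = S.matA * P * S.matCᵀ := by
  rw [gain, nonsing_inv_mul_cancel_right _ _
    ((isUnit_iff_isUnit_det _).1 (S.posDef_innovation hV hP).isUnit)]

/-- Since `C` is block diagonal, restricting its factors to `S_i` before multiplying agrees with
restricting the products. The local gain thus inverts a principal submatrix of the full matrix `C P
Cᵀ + V`. -/
lemma localGainRow_eq (P : Matrix (Idx n) (Idx n) ℝ) (i : Fin 3) :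
    S.localGainRow P i = (S.matA * P * S.matCᵀ).submatrix (fun a => ⟨i, a⟩) (nearIncl p i) *
      ((S.matC * P * S.matCᵀ + S.V).submatrix (nearIncl p i) (nearIncl p i))⁻¹ := by
  have hN : S.matA.submatrix (fun a => (⟨i, a⟩ : Idx n)) id * P.submatrix id (nearIncl n i) =
      (S.matA * P).submatrix (fun a => ⟨i, a⟩) (nearIncl n i) :=
    submatrix_mul_equiv S.matA P _ (Equiv.refl _) _
  rw [localGainRow]
  rw [hN, S.submatrix_mul_matC_transpose, S.matC_submatrix_mul, S.submatrix_mul_matC_transpose]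
  rfl

lemma localGainRow_mul (hV : S.V.PosDef) {P : Matrix (Idx n) (Idx n) ℝ} (hP : P.PosSemidef)
    (i : Fin 3) :
    S.localGainRow P i *
        (S.matC * P * S.matCᵀ + S.V).submatrix (nearIncl p i) (nearIncl p i) =
      (S.matA * P * S.matCᵀ).submatrix (fun a => ⟨i, a⟩) (nearIncl p i) := by
  have hpos : ((S.matC * P * S.matCᵀ + S.V).submatrix (nearIncl p i) (nearIncl p i)).PosDef :=
    (S.posDef_innovation hV hP).submatrix Subtype.val_injective
  rw [localGainRow_eq, nonsing_inv_mul_cancel_right _ _ ((isUnit_iff_isUnit_det _).1 hpos.isUnit)]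

lemma localGain_apply_of_not_near {P : Matrix (Idx n) (Idx n) ℝ} {a : Idx n} {c : Idx p}
    (h : ¬ near a.1 c.1) : S.localGain P a c = 0 := by
  simp [localGain, h]

/-- The normal equations are asserted only in columns of `S_i`: a player's residual need be
orthogonal only to innovations it sees. -/
lemma localGain_mul_apply (hV : S.V.PosDef) {P : Matrix (Idx n) (Idx n) ℝ} (hP : P.PosSemidef)
    {a : Idx n} {b : Idx p} (hb : near a.1 b.1) :
    (S.localGain P * (S.matC * P * S.matCᵀ + S.V)) a b = (S.matA * P * S.matCᵀ) a b := by
  have h := congrFun (congrFun (S.localGainRow_mul hV hP a.1) a.2) ⟨b, hb⟩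
  rw [submatrix_apply] at h
  rw [show (S.matA * P * S.matCᵀ) a b = (S.matA * P * S.matCᵀ) ⟨a.1, a.2⟩ b from rfl, ← h,
    Matrix.mul_apply, Matrix.mul_apply, ← sum_near a.1 fun c hc => by
      rw [S.localGain_apply_of_not_near hc, zero_mul]]
  refine Finset.sum_congr rfl fun c _ => ?_
  simp [localGain, c.2]

end System

/-! ### Moments of errors and innovations, and one step of the filter. -/

namespace System.IsClosedLoop

variable {Ω : Type*} [mΩ : MeasurableSpace Ω] {μ : Measure Ω} {n q p : Fin 3 → ℕ}
  {S : System n q p} {x : ℕ → Ω → Idx n → ℝ} {u : ℕ → Ω → Idx q → ℝ} {y : ℕ → Ω → Idx p → ℝ}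
  {w : ℕ → Ω → Idx n → ℝ} {v : ℕ → Ω → Idx p → ℝ}

lemma err_ae_eq_mem (h : S.IsClosedLoop μ x u y w v) (k : ℕ) (a : Idx n) :
    ∃ r ∈ driveSpan (x 0) w v k, (fun ω => err μ x y k ω a) =ᵐ[μ] r :=
  h.exists_sub_condExp_eq (isClosedInTime_pastSet k) subset_rfl (localSet_subset_pastSet _ _)

lemma localErr_ae_eq_mem (h : S.IsClosedLoop μ x u y w v) (k : ℕ) (a : Idx n) :
    ∃ r ∈ driveSpan (x 0) w v k, (fun ω => localErr μ x y k ω a) =ᵐ[μ] r :=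
  h.exists_sub_condExp_eq (isClosedInTime_localSet a.1 k) (localSet_subset_pastSet _ _) subset_rfl

lemma isCentredL2_of_ae_eq_mem (h : S.IsClosedLoop μ x u y w v) {k : ℕ} {ι : Type*}
    {E : Ω → ι → ℝ} (hE : ∀ a, ∃ r ∈ driveSpan (x 0) w v k, (fun ω => E ω a) =ᵐ[μ] r) :
    IsCentredL2 μ E := by
  intro a
  obtain ⟨r, hr, he⟩ := hE a
  have h1 := h.memLp_of_mem_driveSpan hr
  exact ⟨(memLp_congr_ae he).2 h1.1, (integral_congr_ae he).trans h1.2⟩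

lemma crossMoment_v_of_ae_eq_mem (h : S.IsClosedLoop μ x u y w v) {k : ℕ} {ι : Type*}
    {E : Ω → ι → ℝ} (hE : ∀ a, ∃ r ∈ driveSpan (x 0) w v k, (fun ω => E ω a) =ᵐ[μ] r) :
    crossMoment μ (v k) E = 0 := by
  ext b a
  obtain ⟨r, hr, he⟩ := hE a
  refine (integral_congr_ae ?_).trans (h.integral_v_mul hr b)
  filter_upwards [he] with ω hω
  rw [hω]

lemma crossMoment_w_of_ae_eq_mem (h : S.IsClosedLoop μ x u y w v) {k : ℕ} {ι : Type*}
    {E : Ω → ι → ℝ} (hE : ∀ a, ∃ r ∈ driveSpan (x 0) w v k, (fun ω => E ω a) =ᵐ[μ] r) :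
    crossMoment μ (w k) E = 0 := by
  ext b a
  obtain ⟨r, hr, he⟩ := hE a
  refine (integral_congr_ae ?_).trans (h.integral_w_mul hr b)
  filter_upwards [he] with ω hω
  rw [hω]

lemma crossMoment_v_v (h : S.IsClosedLoop μ x u y w v) (k : ℕ) :
    crossMoment μ (v k) (v k) = S.V := by
  ext a b
  exact (h.cov_v k k a b).trans (if_pos rfl)

lemma crossMoment_w_v (h : S.IsClosedLoop μ x u y w v) (k : ℕ) :
    crossMoment μ (w k) (v k) = 0 := by
  ext a b
  exact h.cov_w_v k k a b

lemma isL2_err (h : S.IsClosedLoop μ x u y w v) (k : ℕ) : IsL2 μ (err μ x y k) :=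
  fun a => (h.isCentredL2_of_ae_eq_mem (h.err_ae_eq_mem k) a).1

lemma isL2_localErr (h : S.IsClosedLoop μ x u y w v) (k : ℕ) : IsL2 μ (localErr μ x y k) :=
  fun a => (h.isCentredL2_of_ae_eq_mem (h.localErr_ae_eq_mem k) a).1

lemma innov_eq (h : S.IsClosedLoop μ x u y w v) (k : ℕ) :
    innov S.matC μ x y k = (fun ω => S.matC *ᵥ err μ x y k ω) + v k := by
  ext1 ω
  rw [Pi.add_apply, innov, err, h.output, mulVec_sub]
  abel

lemma localInnov_eq (h : S.IsClosedLoop μ x u y w v) (k : ℕ) :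
    localInnov S.matC μ x y k = (fun ω => S.matC *ᵥ localErr μ x y k ω) + v k := by
  ext1 ω
  rw [Pi.add_apply, localInnov, localErr, h.output, mulVec_sub]
  abel

lemma isL2_innov (h : S.IsClosedLoop μ x u y w v) (k : ℕ) : IsL2 μ (innov S.matC μ x y k) := by
  rw [h.innov_eq]
  exact ((h.isL2_err k).mulVec _).add (h.isL2_v k)

lemma isCentredL2_mulVec_add_v (h : S.IsClosedLoop μ x u y w v) {k : ℕ} {E : Ω → Idx n → ℝ}
    (hE : IsCentredL2 μ E) : IsCentredL2 μ ((fun ω => S.matC *ᵥ E ω) + v k) := by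
  have := h.gaussian.isProbabilityMeasure
  have hL : IsL2 μ E := fun a => (hE a).1
  refine fun b => ⟨(hL.mulVec S.matC).add (h.isL2_v k) b, ?_⟩
  have h1 : ∫ ω, (S.matC *ᵥ E ω) b ∂μ = 0 := by
    simp only [mulVec, dotProduct]
    rw [integral_finsetSum _ fun c _ => ((hL c).integrable one_le_two).const_mul _]
    exact Finset.sum_eq_zero fun c _ => by rw [integral_const_mul, (hE c).2, mul_zero]
  refine (integral_add ((hL.mulVec S.matC b).integrable one_le_two)
    ((h.isL2_v k b).integrable one_le_two)).trans ?_
  rw [h1, h.integral_v, add_zero]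

/-- Second moments of `C E + v(k)` for an error `E` determined before time `k`. -/
lemma crossMoment_mulVec_add_v (h : S.IsClosedLoop μ x u y w v) {k : ℕ} {E : Ω → Idx n → ℝ}
    (hE : ∀ a, ∃ r ∈ driveSpan (x 0) w v k, (fun ω => E ω a) =ᵐ[μ] r) :
    crossMoment μ ((fun ω => S.matC *ᵥ E ω) + v k) ((fun ω => S.matC *ᵥ E ω) + v k) =
      S.matC * crossMoment μ E E * S.matCᵀ + S.V := by
  have hL : IsL2 μ E := fun a => (h.isCentredL2_of_ae_eq_mem hE a).1
  have hv := h.isL2_v k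
  have hCE := hL.mulVec S.matC
  have h0 := h.crossMoment_v_of_ae_eq_mem hE
  have h1 : crossMoment μ E (v k) = 0 := by rw [← crossMoment_transpose, h0, transpose_zero]
  rw [crossMoment_add_left hCE hv (hCE.add hv), crossMoment_add_right hCE hCE hv,
    crossMoment_add_right hv hCE hv, crossMoment_mulVec_left hL hCE,
    crossMoment_mulVec_left hL hv, crossMoment_mulVec_right hL hL,
    crossMoment_mulVec_right hv hL, h0, h1, h.crossMoment_v_v, Matrix.mul_zero, Matrix.zero_mul,
    add_zero, zero_add, Matrix.mul_assoc]

lemma localCovY_eq (h : S.IsClosedLoop μ x u y w v) (k : ℕ) :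
    localCovY S.matC μ x y k = S.matC * localCovP μ x y k * S.matCᵀ + S.V := by
  rw [localCovY, h.localInnov_eq]
  exact h.crossMoment_mulVec_add_v (h.localErr_ae_eq_mem k)

lemma posSemidef_covP (h : S.IsClosedLoop μ x u y w v) (k : ℕ) : (covP μ x y k).PosSemidef :=
  crossMoment_posSemidef (h.isL2_err k)

/-- The residual `A e(k) + w(k) - L ỹ(k)` and the innovation at time `k`. -/
lemma crossMoment_residual (h : S.IsClosedLoop μ x u y w v) {k : ℕ} {E : Ω → Idx n → ℝ}
    (hE : ∀ a, ∃ r ∈ driveSpan (x 0) w v k, (fun ω => E ω a) =ᵐ[μ] r)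
    (L : Matrix (Idx n) (Idx p) ℝ) :
    crossMoment μ ((fun ω => S.matA *ᵥ E ω) + w k -
        fun ω => L *ᵥ ((fun ω => S.matC *ᵥ E ω) + v k) ω) ((fun ω => S.matC *ᵥ E ω) + v k) =
      S.matA * crossMoment μ E E * S.matCᵀ -
        L * (S.matC * crossMoment μ E E * S.matCᵀ + S.V) := by
  have hL : IsL2 μ E := fun a => (h.isCentredL2_of_ae_eq_mem hE a).1
  have hv := h.isL2_v k
  have hw := h.isL2_w k
  have hCE := hL.mulVec S.matC
  have hν := hCE.add hv
  have h1 : crossMoment μ E (v k) = 0 := by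
    rw [← crossMoment_transpose, h.crossMoment_v_of_ae_eq_mem hE, transpose_zero]
  rw [crossMoment_sub_left ((hL.mulVec _).add hw) (hν.mulVec L) hν,
    crossMoment_mulVec_left hν hν, h.crossMoment_mulVec_add_v hE,
    crossMoment_add_left (hL.mulVec _) hw hν, crossMoment_mulVec_left hL hν,
    crossMoment_add_right hL hCE hv, crossMoment_add_right hw hCE hv, h1, h.crossMoment_w_v,
    crossMoment_mulVec_right hL hL, crossMoment_mulVec_right hw hL,
    h.crossMoment_w_of_ae_eq_mem hE, Matrix.zero_mul, add_zero, add_zero, add_zero,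
    ← Matrix.mul_assoc S.matA]

/-- One step of the filter: if the gain `L` uses only measurements in `T` in row `a` and solves the
normal equations for these measurements, then it gives the estimate of `x(k+1)` from `T`. -/
lemma error_update (h : S.IsClosedLoop μ x u y w v) {T : Set (Fin 3 × ℕ)} {k : ℕ}
    (hT : IsClosedInTime T) (hTk : T ⊆ pastSet (k + 1)) {a : Idx n}
    (haT : localSet a.1 (k + 1) ⊆ T) (L : Matrix (Idx n) (Idx p) ℝ)
    (hLT : ∀ c, L a c ≠ 0 → (c.1, k) ∈ T)
    (hL : ∀ b : Idx p, (b.1, k) ∈ T →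
      (L * (S.matC * covP μ x y k * S.matCᵀ + S.V)) a b = (S.matA * covP μ x y k * S.matCᵀ) a b) :
    (fun ω => x (k + 1) ω a - (μ[fun ω' => x (k + 1) ω' a | obsSigma y T]) ω) =ᵐ[μ]
      fun ω => ((fun ω => S.matA *ᵥ err μ x y k ω) + w k -
        fun ω => L *ᵥ innov S.matC μ x y k ω) ω a := by
  -- `z` is the linear prediction of the free state from the free outputs before `k`. The error is
  -- replaced by `E`, which equals it almost surely and lies exactly in the linear span.
  choose z hz hzorth using h.exists_regression (finite_pastSet k) k
  have hpast : pastSet k ⊆ T := (pastSet_subset_localSet_succ a.1 k).trans haT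
  set E : Ω → Idx n → ℝ := fun ω c => S.freeState (x 0) w k ω c - z c ω with hEdef
  have herr : ∀ c, (fun ω => err μ x y k ω c) =ᵐ[μ] fun ω => E ω c := fun c =>
    h.sub_condExp_eq (isClosedInTime_pastSet k) (localSet_subset_pastSet _ _) (hz c) (hzorth c)
  have hEmem : ∀ c, ∃ r ∈ driveSpan (x 0) w v k, (fun ω => E ω c) =ᵐ[μ] r := fun c =>
    ⟨_, Submodule.sub_mem _ (S.freeState_mem (x 0) w v k c)
      (S.span_obsFun_freeOutput_le (x 0) w v subset_rfl (hz c)), ae_eq_rfl⟩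
  have hEL : IsL2 μ E := fun c => (h.isCentredL2_of_ae_eq_mem hEmem c).1
  set ν : Ω → Idx p → ℝ := (fun ω => S.matC *ᵥ E ω) + v k with hν
  have hνL : IsL2 μ ν := (hEL.mulVec _).add (h.isL2_v k)
  set R : Ω → Idx n → ℝ := (fun ω => S.matA *ᵥ E ω) + w k - fun ω => L *ᵥ ν ω with hR
  have hRL : IsL2 μ R := ((hEL.mulVec _).add (h.isL2_w k)).sub (hνL.mulVec L)
  have hzT : ∀ c, z c ∈ Submodule.span ℝ (Set.range (obsFun (S.freeOutput (x 0) w v) T)) :=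
    fun c => span_obsFun_mono _ hpast (hz c)
  have hout : ∀ ω, S.freeOutput (x 0) w v k ω = ν ω + S.matC *ᵥ fun c => z c ω := by
    intro ω
    have : E ω = S.freeState (x 0) w k ω - fun c => z c ω := rfl
    rw [hν, Pi.add_apply, this, mulVec_sub, freeOutput]
    abel
  -- Candidate estimate of the free state at `k + 1`: propagate the prediction through `A` and
  -- correct it by the innovation. Its residual is `R`.
  set g : Ω → ℝ := fun ω => (S.matA *ᵥ fun c => z c ω) a + (L *ᵥ ν ω) a with hg
  have hgmem : g ∈ Submodule.span ℝ (Set.range (obsFun (S.freeOutput (x 0) w v) T)) := by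
    refine Submodule.add_mem _ (mulVec_mem S.matA a fun c _ => hzT c)
      (mulVec_mem L a fun c hc => ?_)
    have : (fun ω => ν ω c) = (fun ω => S.freeOutput (x 0) w v k ω c) -
        fun ω => (S.matC *ᵥ fun c => z c ω) c := by
      ext ω
      simp [hout]
    rw [this]
    exact Submodule.sub_mem _ (mem_span_obsFun _ (hLT c hc)) (mulVec_mem S.matC c fun c _ => hzT c)
  have hres : ∀ ω, S.freeState (x 0) w (k + 1) ω a - g ω = R ω a := by
    intro ω
    have : E ω = S.freeState (x 0) w k ω - fun c => z c ω := rfl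
    simp only [hR, hg, freeState, this, mulVec_sub, Pi.add_apply, Pi.sub_apply]
    ring
  -- `R` is linear in `E`, `w k` and `v k`, each orthogonal to outputs before `k`, whatever `L` is.
  have hRpast : ∀ f ∈ Submodule.span ℝ
      (Set.range (obsFun (S.freeOutput (x 0) w v) (pastSet k))), ∫ ω, R ω a * f ω ∂μ = 0 := by
    intro f hf
    have hfD := S.span_obsFun_freeOutput_le (x 0) w v subset_rfl hf
    have hfL : IsL2 μ fun ω (_ : Unit) => f ω := fun _ => (h.memLp_of_mem_driveSpan hfD).1
    have hfmem : ∀ _ : Unit, ∃ r ∈ driveSpan (x 0) w v k, f =ᵐ[μ] r := fun _ => ⟨f, hfD, ae_eq_rfl⟩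
    have h1 : crossMoment μ E (fun ω (_ : Unit) => f ω) = 0 := by
      ext c _
      refine (integral_mul_eq_zero_of_mem_span (hEL c) ?_ hf).2
      rintro _ ⟨s, rfl⟩
      exact ⟨(h.memLp_of_mem_driveSpan (S.freeOutput_mem (x 0) w v s.1.2 ⟨s.1.1.1, s.2⟩)).1,
        hzorth c s⟩
    have h2 : crossMoment μ R (fun ω (_ : Unit) => f ω) = 0 := by
      rw [hR, crossMoment_sub_left ((hEL.mulVec _).add (h.isL2_w k)) (hνL.mulVec L) hfL,
        crossMoment_mulVec_left hνL hfL, hν,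
        crossMoment_add_left (hEL.mulVec _) (h.isL2_w k) hfL,
        crossMoment_add_left (hEL.mulVec _) (h.isL2_v k) hfL,
        crossMoment_mulVec_left hEL hfL, crossMoment_mulVec_left hEL hfL, h1,
        h.crossMoment_w_of_ae_eq_mem hfmem, h.crossMoment_v_of_ae_eq_mem hfmem]
      simp
    exact congrFun (congrFun h2 a) ()
  have hP : covP μ x y k = crossMoment μ E E := crossMoment_congr herr herr
  have horth : ∀ s, ∫ ω, (S.freeState (x 0) w (k + 1) ω a - g ω) *
      obsFun (S.freeOutput (x 0) w v) T s ω ∂μ = 0 := by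
    rintro ⟨⟨⟨j, t⟩, ht⟩, b⟩
    simp only [hres]
    rcases (Nat.lt_succ_iff.1 (hTk ht)).lt_or_eq with htk | htk
    -- The remaining measurements have time exactly `k`. They split into an innovation, where the
    -- normal equations apply, and `C z`, which lies in the span of the past.
    · exact hRpast _ (mem_span_obsFun (c := ⟨j, b⟩) _ htk)
    · simp only at htk
      subst htk
      have h1 : ∫ ω, R ω a * ν ω ⟨j, b⟩ ∂μ = 0 := by
        have h2 := congrFun (congrFun (h.crossMoment_residual hEmem L) a) ⟨j, b⟩
        rw [Matrix.sub_apply, ← hP, hL ⟨j, b⟩ ht, sub_self] at h2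
        exact h2
      have hCz : (fun ω => (S.matC *ᵥ fun c => z c ω) ⟨j, b⟩) ∈ Submodule.span ℝ
          (Set.range (obsFun (S.freeOutput (x 0) w v) (pastSet t))) :=
        mulVec_mem S.matC _ fun c _ => hz c
      simp only [obsFun, hout, Pi.add_apply, mul_add]
      refine (integral_add ((hRL a).integrable_mul (hνL ⟨j, b⟩)) ((hRL a).integrable_mul
        (h.memLp_of_mem_driveSpan
          (S.span_obsFun_freeOutput_le (x 0) w v subset_rfl hCz)).1)).trans ?_
      exact (congrArg₂ (· + ·) h1 (hRpast _ hCz)).trans (add_zero 0)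
  refine (h.sub_condExp_eq hT haT hgmem horth).trans ?_
  have hall : ∀ᵐ ω ∂μ, ∀ c, err μ x y k ω c = E ω c := ae_all_iff.2 herr
  filter_upwards [hall] with ω hω
  have hω' : err μ x y k ω = E ω := funext hω
  rw [hres ω, h.innov_eq]
  simp only [hR, hν, Pi.sub_apply, Pi.add_apply, hω']

/-! ### Error recursions and the covariance identities. -/

lemma err_succ (h : S.IsClosedLoop μ x u y w v) (hV : S.V.PosDef) (k : ℕ) (a : Idx n) :
    (fun ω => err μ x y (k + 1) ω a) =ᵐ[μ]
      fun ω => ((fun ω => S.matA *ᵥ err μ x y k ω) + w k -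
        fun ω => S.gain (covP μ x y k) *ᵥ innov S.matC μ x y k ω) ω a :=
  h.error_update (isClosedInTime_pastSet _) subset_rfl (localSet_subset_pastSet _ _) _
    (fun _ _ => k.lt_succ_self) fun b _ => by rw [S.gain_mul hV (h.posSemidef_covP k)]

/-- The filter step is applied with a different `T` for each block row. The full error `e(k)`, not
the local one, appears on the right because `y(0:k-1)` is common knowledge at `k + 1`. -/
lemma localErr_succ (h : S.IsClosedLoop μ x u y w v) (hV : S.V.PosDef) (k : ℕ) (a : Idx n) :
    (fun ω => localErr μ x y (k + 1) ω a) =ᵐ[μ]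
      fun ω => ((fun ω => S.matA *ᵥ err μ x y k ω) + w k -
        fun ω => S.localGain (covP μ x y k) *ᵥ innov S.matC μ x y k ω) ω a := by
  refine h.error_update (isClosedInTime_localSet a.1 _) (localSet_subset_pastSet _ _) subset_rfl _
    (fun c hc => mem_localSet_succ_iff.2 ?_) fun b hb =>
      S.localGain_mul_apply hV (h.posSemidef_covP k) (mem_localSet_succ_iff.1 hb)
  by_contra hn
  exact hc (S.localGain_apply_of_not_near hn)

/-- The full gain solves the normal equations in every column. This orthogonality removes the cross
terms from (a) and the first term from (c). -/
lemma crossMoment_err_succ_innov (h : S.IsClosedLoop μ x u y w v) (hV : S.V.PosDef) (k : ℕ) :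
    crossMoment μ (err μ x y (k + 1)) (innov S.matC μ x y k) = 0 := by
  rw [crossMoment_congr (h.err_succ hV k) fun _ => ae_eq_rfl, h.innov_eq]
  refine (h.crossMoment_residual (h.err_ae_eq_mem k) _).trans ?_
  exact sub_eq_zero.2 (S.gain_mul hV (h.posSemidef_covP k)).symm

lemma localErr_succ_eq_err_add (h : S.IsClosedLoop μ x u y w v) (hV : S.V.PosDef) (k : ℕ)
    (a : Idx n) :
    (fun ω => localErr μ x y (k + 1) ω a) =ᵐ[μ] fun ω => (err μ x y (k + 1) +
      fun ω => deltaK S μ x y k *ᵥ innov S.matC μ x y k ω) ω a := by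
  filter_upwards [h.err_succ hV k a, h.localErr_succ hV k a] with ω h1 h2
  simp only [Pi.add_apply, h1, h2, deltaK, sub_mulVec, Pi.sub_apply]
  ring

lemma crossMoment_localErr_succ_innov (h : S.IsClosedLoop μ x u y w v) (hV : S.V.PosDef)
    (k : ℕ) :
    crossMoment μ (localErr μ x y (k + 1)) (innov S.matC μ x y k) =
      deltaK S μ x y k * covY S.matC μ x y k := by
  rw [crossMoment_congr (h.localErr_succ_eq_err_add hV k) fun _ => ae_eq_rfl,
    crossMoment_add_left (h.isL2_err _) ((h.isL2_innov k).mulVec _) (h.isL2_innov k),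
    h.crossMoment_err_succ_innov hV, zero_add,
    crossMoment_mulVec_left (h.isL2_innov k) (h.isL2_innov k), covY]

lemma localCovP_succ (h : S.IsClosedLoop μ x u y w v) (hV : S.V.PosDef) (k : ℕ) :
    localCovP μ x y (k + 1) = covP μ x y (k + 1) +
      deltaK S μ x y k * covY S.matC μ x y k * (deltaK S μ x y k)ᵀ := by
  have he := h.isL2_err (k + 1)
  have hν := h.isL2_innov k
  have hd := hν.mulVec (deltaK S μ x y k)
  have h0 := h.crossMoment_err_succ_innov hV k
  have h1 : crossMoment μ (innov S.matC μ x y k) (err μ x y (k + 1)) = 0 := by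
    rw [← crossMoment_transpose, h0, transpose_zero]
  rw [localCovP, crossMoment_congr (h.localErr_succ_eq_err_add hV k)
      (h.localErr_succ_eq_err_add hV k), crossMoment_add_left he hd (he.add hd),
    crossMoment_add_right he he hd, crossMoment_add_right hd he hd,
    crossMoment_mulVec_right he hν, crossMoment_mulVec_left hν he,
    crossMoment_mulVec_left hν hd, crossMoment_mulVec_right hν hν, h0, h1, Matrix.zero_mul,
    Matrix.mul_zero, add_zero, zero_add, covP, covY, Matrix.mul_assoc]

end System.IsClosedLoop

end ThreePlayer

theorem lemma1 {Ω : Type*} [MeasurableSpace Ω] (μ : Measure Ω) [IsProbabilityMeasure μ]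
    {n q p : Fin 3 → ℕ} (S : ThreePlayer.System n q p)
    (x : ℕ → Ω → ThreePlayer.Idx n → ℝ) (u : ℕ → Ω → ThreePlayer.Idx q → ℝ)
    (y : ℕ → Ω → ThreePlayer.Idx p → ℝ)
    (w : ℕ → Ω → ThreePlayer.Idx n → ℝ) (v : ℕ → Ω → ThreePlayer.Idx p → ℝ)
    (hloop : S.IsClosedLoop μ x u y w v) :
    -- all the errors are square integrable with mean zero
    (∀ k, (∀ s, Integrable (fun ω => x k ω s) μ) ∧
      ThreePlayer.IsCentredL2 μ (ThreePlayer.err μ x y k) ∧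
      ThreePlayer.IsCentredL2 μ (ThreePlayer.localErr μ x y k) ∧
      ThreePlayer.IsCentredL2 μ (ThreePlayer.innov S.matC μ x y k) ∧
      ThreePlayer.IsCentredL2 μ (ThreePlayer.localInnov S.matC μ x y k)) ∧
    -- (a)
    (S.V.PosDef → ∀ k, ThreePlayer.localCovP μ x y (k + 1) =
      ThreePlayer.covP μ x y (k + 1) +
        ThreePlayer.deltaK S μ x y k * ThreePlayer.covY S.matC μ x y k *
          (ThreePlayer.deltaK S μ x y k)ᵀ) ∧
    -- (b)
    (∀ k, ThreePlayer.localCovY S.matC μ x y k =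
      S.matC * ThreePlayer.localCovP μ x y k * S.matCᵀ + S.V) ∧
    (S.V.PosDef → ∀ k, (ThreePlayer.localCovY S.matC μ x y k).PosDef) ∧
    -- (c)
    (S.V.PosDef → ∀ k,
      ThreePlayer.crossMoment μ (ThreePlayer.localErr μ x y (k + 1))
          (ThreePlayer.innov S.matC μ x y k) =
        ThreePlayer.deltaK S μ x y k * ThreePlayer.covY S.matC μ x y k) := by
  refine ⟨fun k => ?_, fun hV k => hloop.localCovP_succ hV k, hloop.localCovY_eq, fun hV k => ?_,
    fun hV k => hloop.crossMoment_localErr_succ_innov hV k⟩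
  · have he := hloop.isCentredL2_of_ae_eq_mem (hloop.err_ae_eq_mem k)
    have hl := hloop.isCentredL2_of_ae_eq_mem (hloop.localErr_ae_eq_mem k)
    refine ⟨hloop.integrable_state k, he, hl, ?_, ?_⟩
    · rw [hloop.innov_eq]
      exact hloop.isCentredL2_mulVec_add_v he
    · rw [hloop.localInnov_eq]
      exact hloop.isCentredL2_mulVec_add_v hl
  · rw [hloop.localCovY_eq]
    -- The argument for the full innovation uses only that the error covariance is positive
    -- semidefinite, so it applies to `P^{[1]}(k)`.
    exact S.posDef_innovation hV (ThreePlayer.crossMoment_posSemidef (hloop.isL2_localErr k))
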